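/- For every $\tau\in\mathbb{C}$ with $\operatorname{Im}\tau>0$, $$\frac{\eta^5(\tau)}{\eta^2(2\tau)}=\sum_{\substack{n\ge 1\\ n\text{ odd}}} n\left(\frac{n}{3}\right)\exp\left(\frac{2\pi i n^2\tau}{24}\right),$$ where the series converges absolutely. Here $\eta(\tau)=q^{1/24}\prod_{n=1}^{\infty}(1-q^n)$, with $q=\exp(2\pi i\tau)$ and $q^{1/24}=\exp(2\pi i\tau/24)$, is the Dedekind eta function, and $\left(\frac{n}{3}\right)$ equals $+1$, $-1$ or $0$ according as $n\equiv 1$, $n\equiv -1$ or $n\equiv 0\pmod 3$. -/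

import Mathlib

open scoped UpperHalfPlane

namespace EtaQuotient

open Filter Topology

/-! Write E(q) for `eulerProd q`. Jacobi's series for -E(q)^3 times Gauss's series for E(q)^2/E(q^2)
is a double series over ℤ × ℤ with sum -E(q)^5/E(q^2). After the shear (n, j) ↦ (n + 2j, j) its
weight is n + 2j; the part 2j contributes a multiple of ∑ (-1)^m q^(m(m-1)/2) = 0, so the weight may
be replaced by n (`hasSum_doubleTerm`). For fixed n, the sum over j is a monomial multiple of the
pentagonal series for E(q^2) if n ≡ 0, 1 mod 3, and vanishes by a reflection if n ≡ 2. Collecting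
the classes gives `hasSum_six_mul_add_one`. The factor q^(1/24) turns its exponents into
(6k+1)^2/24, and |6k+1| runs once through the odd n prime to 3.

The theta series come from the Jacobi triple product, obtained as a limit of a finite identity for
Gaussian binomials; Jacobi's cube identity is the limit of the derivative of that finite identity at
y = -1. -/

lemma hasSum_congr {ι : Type*} {f g : ι → ℂ} {a b : ℂ} (h : HasSum f a) (hf : ∀ i, g i = f i)
    (hb : b = a) : HasSum g b := by
  rwa [funext hf, hb]

/-! ### Gaussian binomials and finite product identities -/

/-- The integer `j * (j - 1) / 2`. -/
def tri (j : ℤ) : ℤ := j * (j - 1) / 2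

lemma two_mul_tri (j : ℤ) : 2 * tri j = j * (j - 1) :=
  Int.two_mul_ediv_two_of_even (by grind)

lemma tri_add_one (j : ℤ) : tri (j + 1) = tri j + j := by
  have h1 := two_mul_tri j
  have h2 := two_mul_tri (j + 1)
  linarith

/-- The finite product `(1 - q) (1 - q ^ 2) ⋯ (1 - q ^ n)`. -/
noncomputable def eulerPartial (q : ℂ) (n : ℕ) : ℂ := ∏ i ∈ Finset.range n, (1 - q ^ (i + 1))

/-- The infinite product `(1 - q) (1 - q ^ 2) (1 - q ^ 3) ⋯`. -/
noncomputable def eulerProd (q : ℂ) : ℂ := ∏' n : ℕ, (1 - q ^ (n + 1))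

/-- The reciprocal of `eulerPartial`, extended by zero to negative integers. -/
noncomputable def invEuler (q : ℂ) : ℤ → ℂ
  | .ofNat n => (eulerPartial q n)⁻¹
  | .negSucc _ => 0

/-- The central Gaussian binomial coefficient `[2m, m + j]`. -/
noncomputable def centralCoeff (q : ℂ) (m : ℕ) (j : ℤ) : ℂ :=
  eulerPartial q (2 * m) * invEuler q (m + j) * invEuler q (m - j)

lemma one_sub_pow_ne_zero {q : ℂ} (hq : ‖q‖ < 1) (n : ℕ) : 1 - q ^ (n + 1) ≠ 0 := by
  intro h
  have : ‖q ^ (n + 1)‖ = 1 := by rw [← sub_eq_zero.mp h]; simp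
  rw [norm_pow] at this
  exact absurd this (pow_lt_one₀ (norm_nonneg _) hq (by simp)).ne

lemma eulerPartial_ne_zero {q : ℂ} (hq : ‖q‖ < 1) (n : ℕ) : eulerPartial q n ≠ 0 :=
  Finset.prod_ne_zero_iff.mpr fun _ _ ↦ one_sub_pow_ne_zero hq _

lemma eulerPartial_succ (q : ℂ) (n : ℕ) :
    eulerPartial q (n + 1) = eulerPartial q n * (1 - q ^ (n + 1)) :=
  Finset.prod_range_succ _ _

/-- Extension by zero is what makes this recurrence valid on all of ℤ: at n = 0 the factor 1 - q^0
vanishes. -/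
lemma invEuler_sub_one {q : ℂ} (hq : ‖q‖ < 1) (n : ℤ) :
    invEuler q (n - 1) = (1 - q ^ n) * invEuler q n := by
  rcases n with (_ | n) | n
  · change (0 : ℂ) = _
    simp
  · have : (Int.ofNat (n + 1) - 1) = Int.ofNat n := by simp
    rw [this]
    have h1 := eulerPartial_ne_zero hq n
    have h2 := one_sub_pow_ne_zero hq n
    simp only [invEuler, eulerPartial_succ, Int.ofNat_eq_natCast, zpow_natCast]
    field_simp
  · have : (Int.negSucc n - 1) = Int.negSucc (n + 1) := by
      simp [Int.negSucc_eq]; ring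
    rw [this]
    simp [invEuler]

/-- With u = q^(m+1+j) and v = q^(m+1-j), every term is a multiple of one common product of
`invEuler` values, and q^(2m+1) = uv/q; what remains is a polynomial identity in u, v, q. -/
lemma centralCoeff_succ {q : ℂ} (hq : ‖q‖ < 1) (hq0 : q ≠ 0) (m : ℕ) (j : ℤ) :
    centralCoeff q (m + 1) j = (1 + q ^ (2 * m + 1)) * centralCoeff q m j
      + q ^ (m + 1 - j) * centralCoeff q m (j - 1) + q ^ (m + 1 + j) * centralCoeff q m (j + 1) := by
  set u : ℂ := q ^ ((m : ℤ) + 1 + j) with hu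
  set v : ℂ := q ^ ((m : ℤ) + 1 - j) with hv
  have huv : q ^ (2 * m + 1) * q = u * v := by
    rw [hu, hv, ← zpow_add₀ hq0, ← pow_succ, ← zpow_natCast]
    congr 1
    push_cast
    ring
  have hu' : q ^ ((m : ℤ) + j) = u / q := by
    rw [hu, eq_div_iff hq0, ← zpow_add_one₀ hq0]
    ring_nf
  have hv' : q ^ ((m : ℤ) - j) = v / q := by
    rw [hv, eq_div_iff hq0, ← zpow_add_one₀ hq0]
    ring_nf
  have a1 : invEuler q (m + j) = (1 - u) * invEuler q (m + 1 + j) := by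
    rw [hu, ← invEuler_sub_one hq]; ring_nf
  have a2 : invEuler q (m + (j - 1)) = (1 - u / q) * ((1 - u) * invEuler q (m + 1 + j)) := by
    rw [← hu', ← a1, ← invEuler_sub_one hq]; ring_nf
  have b1 : invEuler q (m - j) = (1 - v) * invEuler q (m + 1 - j) := by
    rw [hv, ← invEuler_sub_one hq]; ring_nf
  have b2 : invEuler q (m - (j + 1)) = (1 - v / q) * ((1 - v) * invEuler q (m + 1 - j)) := by
    rw [← hv', ← b1, ← invEuler_sub_one hq]; ring_nf
  have e : eulerPartial q (2 * (m + 1))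
      = eulerPartial q (2 * m) * (1 - q ^ (2 * m + 1)) * (1 - q ^ (2 * m + 2)) := by
    rw [show 2 * (m + 1) = 2 * m + 1 + 1 by ring, eulerPartial_succ, eulerPartial_succ]
  have p1 : q ^ (2 * m + 1) = u * v / q := by rw [← huv]; field_simp
  have p2 : q ^ (2 * m + 2) = u * v := by rw [← huv, pow_succ]
  simp only [centralCoeff]
  rw [a1, a2, b1, b2, e, p1, p2, show (m : ℤ) + (j + 1) = m + 1 + j by ring,
    show (m : ℤ) - (j - 1) = m + 1 - j by ring]
  push_cast
  field_simp
  ring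

/-- A finite form of the Jacobi triple product identity. -/
lemma hasSum_centralCoeff {q : ℂ} (hq : ‖q‖ < 1) (hq0 : q ≠ 0) {y : ℂ} (hy : y ≠ 0) (m : ℕ) :
    HasSum (fun j : ℤ ↦ centralCoeff q m j * q ^ tri j * y ^ j)
      (∏ i ∈ Finset.range m, ((1 + y * q ^ i) * (1 + y⁻¹ * q ^ (i + 1)))) := by
  induction m with
  | zero =>
    have h0 : centralCoeff q 0 0 = 1 := by
      have : invEuler q 0 = 1 := by
        change (eulerPartial q 0)⁻¹ = 1
        simp [eulerPartial]
      simp [centralCoeff, this, eulerPartial]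
    refine hasSum_congr (hasSum_ite_eq (0 : ℤ) (1 : ℂ)) (fun j ↦ ?_) (by simp)
    split_ifs with h
    · subst h
      rw [h0]
      simp [tri]
    · have : invEuler q j = 0 ∨ invEuler q (-j) = 0 := by
        rcases j with (_ | j) | j
        · exact absurd rfl h
        · exact Or.inr rfl
        · exact Or.inl rfl
      rcases this with h | h <;> simp [centralCoeff, h]
  | succ m ih =>
    rw [Finset.prod_range_succ]
    -- The new factor expands as (1 + q^(2m+1)) + y q^m + y⁻¹ q^(m+1); the last two terms shift j by
    -- one, matching `centralCoeff_succ`.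
    have s1 := (Equiv.subRight (1 : ℤ)).hasSum_iff.mpr ih
    have s2 := (Equiv.addRight (1 : ℤ)).hasSum_iff.mpr ih
    refine hasSum_congr (((ih.mul_left (1 + q ^ (2 * m + 1))).add (s1.mul_left (y * q ^ m))).add
      (s2.mul_left (y⁻¹ * q ^ (m + 1)))) (fun j ↦ ?_) ?_
    · have t1 : tri j = tri (j - 1) + (j - 1) := by
        rw [← tri_add_one]; ring_nf
      have t2 := tri_add_one j
      simp only [Function.comp_apply, Equiv.subRight_apply, Equiv.coe_addRight]
      have y1 : y ^ j = y * y ^ (j - 1) := by rw [← zpow_one_add₀ hy]; ring_nf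
      have y2 : y ^ (j + 1) = y * y ^ j := by rw [← zpow_one_add₀ hy]; ring_nf
      have q1 : q ^ ((m : ℤ) + 1 - j) * q ^ tri j = q ^ m * q ^ tri (j - 1) := by
        rw [← zpow_natCast, ← zpow_add₀ hq0, ← zpow_add₀ hq0, t1]; ring_nf
      have q2 : q ^ ((m : ℤ) + 1 + j) * q ^ tri j = q ^ (m + 1) * q ^ tri (j + 1) := by
        rw [← zpow_natCast, ← zpow_add₀ hq0, ← zpow_add₀ hq0, t2]; push_cast; ring_nf
      rw [centralCoeff_succ hq hq0]
      linear_combination (centralCoeff q m (j - 1) * y ^ j) * q1 +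
        (centralCoeff q m (j + 1) * y ^ j) * q2 +
        (centralCoeff q m (j - 1) * q ^ m * q ^ tri (j - 1)) * y1 -
        (centralCoeff q m (j + 1) * q ^ (m + 1) * q ^ tri (j + 1) * y⁻¹) * y2 -
        (centralCoeff q m (j + 1) * q ^ (m + 1) * q ^ tri (j + 1) * y ^ j) * (mul_inv_cancel₀ hy)
    · linear_combination (∏ i ∈ Finset.range m, ((1 + y * q ^ i) * (1 + y⁻¹ * q ^ (i + 1)))) *
        (q ^ m * q ^ (m + 1)) * (mul_inv_cancel₀ hy)

lemma centralCoeff_eq_zero {q : ℂ} {m : ℕ} {j : ℤ} (h : j ∉ Finset.Icc (-m : ℤ) m) :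
    centralCoeff q m j = 0 := by
  have neg {n : ℤ} (hn : n < 0) : invEuler q n = 0 := by
    rcases n with n | n
    · simp at hn; omega
    · rfl
  rw [Finset.mem_Icc, not_and_or] at h
  rcases h with h | h
  · simp [centralCoeff, neg (n := m + j) (by omega)]
  · simp [centralCoeff, neg (n := m - j) (by omega)]

/-- A finite form of Jacobi's identity for the cube of the Euler product. -/
lemma hasSum_centralCoeff_mul_int {q : ℂ} (hq : ‖q‖ < 1) (hq0 : q ≠ 0) (m : ℕ) :
    HasSum (fun j : ℤ ↦ centralCoeff q (m + 1) j * (j * (-1) ^ j * q ^ tri j))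
      (-(eulerPartial q m * eulerPartial q (m + 1))) := by
  refine hasSum_congr (hasSum_sum_of_ne_finset_zero
    (s := Finset.Icc (-(m + 1 : ℕ) : ℤ) (m + 1 : ℕ)) fun j hj ↦ by
      rw [centralCoeff_eq_zero hj, zero_mul]) (fun j ↦ rfl) ?_
  set s := Finset.Icc (-(m + 1 : ℕ) : ℤ) (m + 1 : ℕ)
  have hfin {y : ℂ} (hy : y ≠ 0) :
      (∏ i ∈ Finset.range (m + 1), ((1 + y * q ^ i) * (1 + y⁻¹ * q ^ (i + 1)))) =
      ∑ j ∈ s, centralCoeff q (m + 1) j * q ^ tri j * y ^ j :=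
    (hasSum_centralCoeff hq hq0 hy (m + 1)).unique
      (hasSum_sum_of_ne_finset_zero fun j hj ↦ by simp [centralCoeff_eq_zero hj])
  have d1 : HasDerivAt (fun y : ℂ ↦ ∑ j ∈ s, centralCoeff q (m + 1) j * q ^ tri j * y ^ j)
      (∑ j ∈ s, centralCoeff q (m + 1) j * q ^ tri j * (j * (-1) ^ (j - 1))) (-1) :=
    HasDerivAt.fun_sum fun j _ ↦ (hasDerivAt_zpow j (-1 : ℂ) (by simp)).const_mul _
  -- The product without its factor 1 + y. As that factor vanishes at -1, the derivative of the
  -- product there is g(-1).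
  let g : ℂ → ℂ := fun y ↦ (∏ i ∈ Finset.range m, (1 + y * q ^ (i + 1))) *
    ∏ i ∈ Finset.range (m + 1), (1 + y⁻¹ * q ^ (i + 1))
  have hg : DifferentiableAt ℂ g (-1) := by
    refine DifferentiableAt.mul ?_ ?_
    · exact DifferentiableAt.fun_finsetProd fun i _ ↦ by fun_prop
    · refine DifferentiableAt.fun_finsetProd fun i _ ↦ ?_
      have : DifferentiableAt ℂ (fun y : ℂ ↦ y⁻¹) (-1) := differentiableAt_inv (by simp)
      fun_prop
  have d2 : HasDerivAt (fun y : ℂ ↦ (1 + y) * g y) (1 * g (-1) + (1 + -1) * deriv g (-1)) (-1) :=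
    ((hasDerivAt_id _).const_add 1).mul hg.hasDerivAt
  have heq : (fun y : ℂ ↦ (1 + y) * g y) =ᶠ[𝓝 (-1)]
      fun y : ℂ ↦ ∑ j ∈ s, centralCoeff q (m + 1) j * q ^ tri j * y ^ j := by
    filter_upwards [isOpen_ne.mem_nhds (show (-1 : ℂ) ≠ 0 by simp)] with y hy
    rw [← hfin hy, Finset.prod_mul_distrib, Finset.prod_range_succ']
    simp only [g, pow_zero, mul_one]
    ring
  have key := (d2.congr_of_eventuallyEq heq.symm).unique d1
  have hg1 : g (-1) = eulerPartial q m * eulerPartial q (m + 1) := by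
    simp [g, eulerPartial, inv_neg, sub_eq_add_neg]
  rw [hg1] at key
  have : eulerPartial q m * eulerPartial q (m + 1) =
      ∑ j ∈ s, centralCoeff q (m + 1) j * q ^ tri j * (j * (-1) ^ (j - 1)) := by
    rw [← key]; ring
  rw [this, ← Finset.sum_neg_distrib]
  refine Finset.sum_congr rfl fun j _ ↦ ?_
  rw [zpow_sub_one₀ (by simp)]
  simp
  ring

/-! ### Passage to the limit -/

lemma tendsto_eulerPartial {q : ℂ} (hq : ‖q‖ < 1) :
    Tendsto (eulerPartial q) atTop (𝓝 (eulerProd q)) :=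
  (ModularForm.multipliable_one_sub_pow hq).hasProd.tendsto_prod_nat

lemma eulerProd_ne_zero {q : ℂ} (hq : ‖q‖ < 1) : eulerProd q ≠ 0 := by
  simp only [eulerProd, sub_eq_add_neg]
  refine tprod_one_add_ne_zero_of_summable (fun i ↦ ?_) ?_
  · simpa [sub_eq_add_neg] using one_sub_pow_ne_zero hq i
  · simpa using (summable_nat_add_iff 1).mpr (summable_geometric_of_lt_one (norm_nonneg _) hq)

lemma exists_norm_centralCoeff_le {q : ℂ} (hq : ‖q‖ < 1) :
    ∃ C : ℝ, ∀ m j, ‖centralCoeff q m j‖ ≤ C := by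
  obtain ⟨A, hA⟩ := (Metric.isBounded_range_of_tendsto _
    (tendsto_eulerPartial hq)).exists_norm_le
  obtain ⟨B, hB⟩ := (Metric.isBounded_range_of_tendsto _
    ((tendsto_eulerPartial hq).inv₀ (eulerProd_ne_zero hq))).exists_norm_le
  have hA' (n : ℕ) : ‖eulerPartial q n‖ ≤ A := hA _ ⟨n, rfl⟩
  have hB' (n : ℕ) : ‖(eulerPartial q n)⁻¹‖ ≤ B := hB _ ⟨n, rfl⟩
  have hB0 : 0 ≤ B := (norm_nonneg _).trans (hB' 0)
  have hA0 : 0 ≤ A := (norm_nonneg _).trans (hA' 0)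
  have hB2 : ∀ n : ℤ, ‖invEuler q n‖ ≤ B
    | .ofNat n => hB' n
    | .negSucc n => by simpa [invEuler] using hB0
  refine ⟨A * B * B, fun m j ↦ ?_⟩
  rw [centralCoeff, norm_mul, norm_mul]
  gcongr
  exacts [hA' _, hB2 _, hB2 _]

lemma tendsto_centralCoeff {q : ℂ} (hq : ‖q‖ < 1) (j : ℤ) :
    Tendsto (fun m ↦ centralCoeff q m j) atTop (𝓝 (eulerProd q)⁻¹) := by
  have h0 := eulerProd_ne_zero hq
  have h1 : Tendsto (fun n : ℤ ↦ invEuler q n) atTop (𝓝 (eulerProd q)⁻¹) := by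
    rw [← Nat.map_cast_int_atTop, tendsto_map'_iff]
    exact (tendsto_eulerPartial hq).inv₀ h0
  have c : Tendsto (fun m : ℕ ↦ (m : ℤ)) atTop atTop := tendsto_natCast_atTop_atTop
  have h2 : Tendsto (fun m : ℕ ↦ invEuler q (m + j)) atTop (𝓝 (eulerProd q)⁻¹) :=
    h1.comp (tendsto_atTop_add_const_right _ j c)
  have h3 : Tendsto (fun m : ℕ ↦ invEuler q (m - j)) atTop (𝓝 (eulerProd q)⁻¹) :=
    h1.comp (tendsto_atTop_add_const_right _ (-j) c)
  have h4 : Tendsto (fun m : ℕ ↦ eulerPartial q (2 * m)) atTop (𝓝 (eulerProd q)) :=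
    (tendsto_eulerPartial hq).comp (tendsto_id.const_mul_atTop' (by simp))
  have h5 := (h4.mul h2).mul h3
  rwa [mul_inv_cancel₀ h0, one_mul] at h5

/-- Tannery's theorem: the coefficients are bounded uniformly in m and j and tend to E(q)⁻¹ for each
j. -/
lemma hasSum_of_hasSum_centralCoeff {q : ℂ} (hq : ‖q‖ < 1) {a : ℤ → ℂ} {p : ℕ → ℂ} {L : ℂ}
    (ha : Summable a) (hp : ∀ᶠ m in atTop, HasSum (fun j ↦ centralCoeff q m j * a j) (p m))
    (hL : Tendsto p atTop (𝓝 L)) : HasSum a (eulerProd q * L) := by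
  obtain ⟨C, hC⟩ := exists_norm_centralCoeff_le hq
  have h := tendsto_tsum_of_dominated_convergence (ha.norm.mul_left C)
    (f := fun m j ↦ centralCoeff q m j * a j) (𝓕 := atTop)
    (fun j ↦ (tendsto_centralCoeff hq j).mul_const (a j))
    (Eventually.of_forall fun m j ↦ by rw [norm_mul]; gcongr; exact hC m j)
  have h' := tendsto_nhds_unique (h.congr' (hp.mono fun m hm ↦ hm.tsum_eq)) hL
  rw [tsum_mul_left] at h'
  rw [← h', mul_inv_cancel_left₀ (eulerProd_ne_zero hq)]
  exact ha.hasSum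

lemma summable_int_pow_mul_zpow_tri {q : ℂ} (hq : ‖q‖ < 1) (hq0 : q ≠ 0) {y : ℂ} (hy : y ≠ 0)
    (k : ℕ) : Summable fun j : ℤ ↦ (j : ℂ) ^ k * (q ^ tri j * y ^ j) := by
  set a := -Real.log ‖q‖ with ha
  have ha0 : 0 < a := neg_pos.mpr (Real.log_neg (norm_pos_iff.mpr hq0) hq)
  -- The parameters make the exponent of the bound -(a/2) j^2 + (a/2 + |log ‖y‖|) |j|, which
  -- dominates the logarithm of the norm of q^(tri j) y^j.
  have hs := summable_pow_mul_jacobiTheta₂_term_bound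
    ((a / 2 + |Real.log ‖y‖|) / (2 * Real.pi)) (T := a / (2 * Real.pi)) (by positivity) k
  refine Summable.of_norm_bounded hs fun j ↦ ?_
  have e (x : ℂ) (hx : x ≠ 0) (n : ℤ) : ‖x‖ ^ n = Real.exp (n * Real.log ‖x‖) := by
    rw [mul_comm, Real.exp_mul, Real.exp_log (norm_pos_iff.mpr hx), Real.rpow_intCast]
  rw [norm_mul, norm_pow, norm_mul, norm_zpow, norm_zpow, e q hq0, e y hy, ← Real.exp_add,
    Complex.norm_intCast, Int.cast_abs]
  gcongr
  have ht : 2 * (tri j : ℝ) = j * (j - 1) := by exact_mod_cast two_mul_tri j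
  have h1 : (j : ℝ) * Real.log ‖y‖ ≤ |(j : ℝ)| * |Real.log ‖y‖| := by
    rw [← abs_mul]; exact le_abs_self _
  have h2 : a * j ≤ a * |(j : ℝ)| := by gcongr; exact le_abs_self _
  have hpi := Real.pi_pos
  have h3 : -Real.pi * (a / (2 * Real.pi) * (j : ℝ) ^ 2 -
      2 * ((a / 2 + |Real.log ‖y‖|) / (2 * Real.pi)) * |(j : ℝ)|) =
      -(a / 2) * (j : ℝ) ^ 2 + (a / 2 + |Real.log ‖y‖|) * |(j : ℝ)| := by
    field_simp
    ring
  rw [h3, show Real.log ‖q‖ = -a by rw [ha, neg_neg]]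
  nlinarith

lemma multipliable_one_add_mul_pow {q : ℂ} (hq : ‖q‖ < 1) (y : ℂ) :
    Multipliable fun i : ℕ ↦ 1 + y * q ^ i := by
  refine multipliable_one_add_of_summable ?_
  simpa using (summable_geometric_of_lt_one (norm_nonneg _) hq).mul_left ‖y‖

/-- The **Jacobi triple product** identity. -/
theorem hasSum_zpow_tri {q : ℂ} (hq : ‖q‖ < 1) (hq0 : q ≠ 0) {y : ℂ} (hy : y ≠ 0) :
    HasSum (fun j : ℤ ↦ q ^ tri j * y ^ j)
      (eulerProd q * ((∏' i : ℕ, (1 + y * q ^ i)) * ∏' i : ℕ, (1 + y⁻¹ * q ^ (i + 1)))) := by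
  refine hasSum_of_hasSum_centralCoeff hq
    (p := fun m ↦ ∏ i ∈ Finset.range m, ((1 + y * q ^ i) * (1 + y⁻¹ * q ^ (i + 1))))
    ?_ (Eventually.of_forall fun m ↦ ?_) ?_
  · simpa using summable_int_pow_mul_zpow_tri hq hq0 hy 0
  · simpa only [mul_assoc] using hasSum_centralCoeff hq hq0 hy m
  · simp only [Finset.prod_mul_distrib]
    refine (multipliable_one_add_mul_pow hq y).hasProd.tendsto_prod_nat.mul ?_
    refine Multipliable.tendsto_prod_tprod_nat ?_
    simpa [pow_succ', mul_assoc] using multipliable_one_add_mul_pow hq (y⁻¹ * q)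

/-- Jacobi's identity for the cube of the Euler product. -/
theorem hasSum_int_mul_zpow_tri {q : ℂ} (hq : ‖q‖ < 1) (hq0 : q ≠ 0) :
    HasSum (fun j : ℤ ↦ (j : ℂ) * (-1) ^ j * q ^ tri j) (-eulerProd q ^ 3) := by
  have h := hasSum_of_hasSum_centralCoeff hq (a := fun j : ℤ ↦ (j : ℂ) * (-1) ^ j * q ^ tri j)
    -- The truncated m - 1 is harmless, since only m ≥ 1 is used.
    (p := fun m ↦ -(eulerPartial q (m - 1) * eulerPartial q m))
    (L := -(eulerProd q * eulerProd q)) ?_ ?_ ?_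
  · convert h using 1; ring
  · refine (summable_int_pow_mul_zpow_tri hq hq0 (y := -1) (by simp) 1).congr fun j ↦ ?_
    ring
  · filter_upwards [eventually_ge_atTop 1] with m hm
    obtain ⟨n, rfl⟩ := Nat.exists_eq_add_of_le' hm
    exact hasSum_centralCoeff_mul_int hq hq0 n
  · exact (((tendsto_eulerPartial hq).comp (tendsto_sub_atTop_nat 1)).mul
      (tendsto_eulerPartial hq)).neg

/-! ### Specialisations of the triple product -/

lemma norm_pow_lt_one {q : ℂ} (hq : ‖q‖ < 1) (n : ℕ) : ‖q ^ (n + 1)‖ < 1 := by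
  rw [norm_pow]
  exact pow_lt_one₀ (norm_nonneg _) hq (by simp)

lemma tendsto_prod_one_sub_mul_pow {q : ℂ} (hq : ‖q‖ < 1) (y : ℂ) :
    Tendsto (fun m ↦ ∏ i ∈ Finset.range m, (1 - y * q ^ i)) atTop
      (𝓝 (∏' i : ℕ, (1 - y * q ^ i))) := by
  refine Multipliable.tendsto_prod_tprod_nat ?_
  simpa [sub_eq_add_neg] using multipliable_one_add_mul_pow hq (-y)

lemma eulerProd_eq_odd_mul_even {q : ℂ} (hq : ‖q‖ < 1) :
    eulerProd q = (∏' i : ℕ, (1 - q * (q ^ 2) ^ i)) * eulerProd (q ^ 2) := by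
  have hq2 : ‖q ^ 2‖ < 1 := norm_pow_lt_one hq 1
  refine tendsto_nhds_unique ((tendsto_eulerPartial hq).comp
    (tendsto_id.const_mul_atTop' (show 0 < 2 by simp)))
    (((tendsto_prod_one_sub_mul_pow hq2 q).mul (tendsto_eulerPartial hq2)).congr fun m ↦ ?_)
  induction m with
  | zero => simp [eulerPartial]
  | succ m ih =>
    simp only [Function.comp_apply, id_eq] at ih ⊢
    rw [show 2 * (m + 1) = 2 * m + 1 + 1 by ring, eulerPartial_succ q (2 * m + 1),
      eulerPartial_succ q (2 * m), ← ih, Finset.prod_range_succ, eulerPartial_succ]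
    ring

lemma eulerProd_eq_mod_three {q : ℂ} (hq : ‖q‖ < 1) :
    eulerProd q = eulerProd (q ^ 3) * ((∏' i : ℕ, (1 - q * (q ^ 3) ^ i)) *
      ∏' i : ℕ, (1 - q ^ 2 * (q ^ 3) ^ i)) := by
  have hq3 : ‖q ^ 3‖ < 1 := norm_pow_lt_one hq 2
  refine tendsto_nhds_unique ((tendsto_eulerPartial hq).comp
    (tendsto_id.const_mul_atTop' (show 0 < 3 by simp)))
    (((tendsto_eulerPartial hq3).mul ((tendsto_prod_one_sub_mul_pow hq3 q).mul
      (tendsto_prod_one_sub_mul_pow hq3 (q ^ 2)))).congr fun m ↦ ?_)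
  induction m with
  | zero => simp [eulerPartial]
  | succ m ih =>
    simp only [Function.comp_apply, id_eq] at ih ⊢
    rw [show 3 * (m + 1) = 3 * m + 1 + 1 + 1 by ring, eulerPartial_succ q (3 * m + 1 + 1),
      eulerPartial_succ q (3 * m + 1), eulerPartial_succ q (3 * m), ← ih, Finset.prod_range_succ, Finset.prod_range_succ, eulerPartial_succ]
    ring

/-- Gauss's product formula for the alternating theta series. -/
theorem hasSum_neg_one_zpow_mul_sq {q : ℂ} (hq : ‖q‖ < 1) (hq0 : q ≠ 0) :
    HasSum (fun j : ℤ ↦ (-1) ^ j * q ^ (j ^ 2)) (eulerProd q ^ 2 / eulerProd (q ^ 2)) := by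
  have hq2 : ‖q ^ 2‖ < 1 := norm_pow_lt_one hq 1
  refine hasSum_congr (hasSum_zpow_tri hq2 (pow_ne_zero 2 hq0) (y := -q) (by simpa))
    (fun j ↦ ?_) ?_
  · rw [← zpow_natCast q 2, ← zpow_mul, neg_eq_neg_one_mul q, mul_zpow, mul_left_comm,
      ← zpow_add₀ hq0, Nat.cast_two, two_mul_tri]
    ring_nf
  · have h (i : ℕ) : 1 + (-q)⁻¹ * (q ^ 2) ^ (i + 1) = 1 - q * (q ^ 2) ^ i := by
      field_simp
      ring
    simp only [h]
    have := eulerProd_ne_zero hq2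
    simp only [eulerProd_eq_odd_mul_even hq, neg_mul, ← sub_eq_add_neg]
    field_simp

/-- Euler's **pentagonal number theorem**. -/
theorem hasSum_pentagonal {q : ℂ} (hq : ‖q‖ < 1) (hq0 : q ≠ 0) :
    HasSum (fun j : ℤ ↦ (-1) ^ j * q ^ (3 * tri j + j)) (eulerProd q) := by
  refine hasSum_congr (hasSum_zpow_tri (norm_pow_lt_one hq 2) (pow_ne_zero 3 hq0) (y := -q)
    (by simpa)) (fun j ↦ ?_) ?_
  · rw [← zpow_natCast q 3, ← zpow_mul, neg_eq_neg_one_mul q, mul_zpow, mul_left_comm,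
      ← zpow_add₀ hq0]
    rfl
  · have h (i : ℕ) : 1 + (-q)⁻¹ * (q ^ 3) ^ (i + 1) = 1 - q ^ 2 * (q ^ 3) ^ i := by
      field_simp
      ring
    simp only [h]
    simp only [eulerProd_eq_mod_three hq, neg_mul, ← sub_eq_add_neg]

lemma hasSum_pentagonal_sq {q : ℂ} (hq : ‖q‖ < 1) (hq0 : q ≠ 0) :
    HasSum (fun j : ℤ ↦ (-1) ^ j * q ^ (3 * j ^ 2 - j)) (eulerProd (q ^ 2)) := by
  refine hasSum_congr (hasSum_pentagonal (norm_pow_lt_one hq 1) (pow_ne_zero 2 hq0))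
    (fun j ↦ ?_) rfl
  rw [← zpow_natCast q, ← zpow_mul]
  congr 2
  push_cast
  linear_combination -3 * two_mul_tri j

lemma hasSum_neg_one_zpow_mul_tri {q : ℂ} (hq : ‖q‖ < 1) (hq0 : q ≠ 0) :
    HasSum (fun j : ℤ ↦ (-1) ^ j * q ^ tri j) 0 := by
  refine hasSum_congr (hasSum_zpow_tri hq hq0 (y := -1) (by simp)) (fun j ↦ mul_comm _ _) ?_
  -- The factor i = 0 is zero.
  have : ∏' i : ℕ, (1 + -1 * q ^ i) = 0 := tprod_of_exists_eq_zero ⟨0, by simp⟩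
  rw [this]
  simp

/-! ### The double series and its residue classes mod 3 -/

/-- The inner summand in the product of the two theta series. -/
noncomputable def doubleTerm (q : ℂ) (n j : ℤ) : ℂ :=
  n * ((-1) ^ n * q ^ tri n) * ((-1) ^ j * q ^ (3 * j ^ 2 + (2 * n - 1) * j))

lemma neg_one_zpow_eq_of_even_sub {a b : ℤ} (h : Even (a - b)) : (-1 : ℂ) ^ a = (-1) ^ b := by
  rw [show a = a - b + b by ring, zpow_add₀ (by simp), h.neg_one_zpow, one_mul]

lemma neg_one_zpow_eq_neg_of_odd_sub {a b : ℤ} (h : Odd (a - b)) : (-1 : ℂ) ^ a = -(-1) ^ b := by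
  rw [show a = a - b + b by ring, zpow_add₀ (by simp), h.neg_one_zpow, neg_one_mul]

/-- The shear `(n, j) ↦ (n + 2j, j)` of the integer lattice. -/
def shear : ℤ × ℤ ≃ ℤ × ℤ where
  toFun x := (x.1 + 2 * x.2, x.2)
  invFun x := (x.1 - 2 * x.2, x.2)
  left_inv x := by simp
  right_inv x := by simp

lemma doubleTerm_eq {q : ℂ} (hq0 : q ≠ 0) (n j : ℤ) :
    doubleTerm q n j = n * ((-1) ^ (n + 2 * j) * q ^ tri (n + 2 * j)) *
      ((-1) ^ j * q ^ (j ^ 2)) := by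
  have h1 : (-1 : ℂ) ^ (n + 2 * j) = (-1) ^ n := neg_one_zpow_eq_of_even_sub ⟨j, by ring⟩
  have h2 : q ^ tri (n + 2 * j) * q ^ (j ^ 2) =
      q ^ tri n * q ^ (3 * j ^ 2 + (2 * n - 1) * j) := by
    rw [← zpow_add₀ hq0, ← zpow_add₀ hq0]
    congr 1
    have t1 := two_mul_tri n
    have t2 := two_mul_tri (n + 2 * j)
    linarith
  rw [h1, doubleTerm]
  linear_combination (-(n * (-1) ^ n * (-1) ^ j) : ℂ) * h2

lemma summable_int_mul_neg_one_zpow_mul_sq {q : ℂ} (hq : ‖q‖ < 1) (hq0 : q ≠ 0) :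
    Summable fun j : ℤ ↦ (j : ℂ) * ((-1) ^ j * q ^ (j ^ 2)) := by
  refine (summable_int_pow_mul_zpow_tri (norm_pow_lt_one hq 1) (pow_ne_zero 2 hq0)
    (y := -q) (by simpa) 1).congr fun j ↦ ?_
  rw [← zpow_natCast q 2, ← zpow_mul, neg_eq_neg_one_mul q, mul_zpow,
    mul_left_comm (q ^ _), ← zpow_add₀ hq0, Nat.cast_two, two_mul_tri]
  ring_nf

lemma hasSum_doubleTerm {q : ℂ} (hq : ‖q‖ < 1) (hq0 : q ≠ 0) :
    HasSum (fun x : ℤ × ℤ ↦ doubleTerm q x.1 x.2)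
      (-eulerProd q ^ 5 / eulerProd (q ^ 2)) := by
  -- Here a, b are the series of Jacobi and Gauss. The correction -2 c d removes the weight 2j; only
  -- convergence of d matters, because c sums to 0.
  have key {a b c d : ℤ → ℂ} {A B D : ℂ} (ha : HasSum a A) (hb : HasSum b B) (hc : HasSum c 0)
      (hd : HasSum d D) :
      HasSum (fun x : ℤ × ℤ ↦ a (shear x).1 * b (shear x).2 -
        2 * (c (shear x).1 * d (shear x).2)) (A * B) := by
    have s1 := ha.mul hb (summable_mul_of_summable_norm ha.summable.norm hb.summable.norm)
    have s2 := hc.mul hd (summable_mul_of_summable_norm hc.summable.norm hd.summable.norm)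
    have s3 := shear.hasSum_iff.mpr (s1.sub (s2.mul_left 2))
    simpa [Function.comp_def] using s3
  refine hasSum_congr (key (hasSum_int_mul_zpow_tri hq hq0) (hasSum_neg_one_zpow_mul_sq hq hq0)
    (hasSum_neg_one_zpow_mul_tri hq hq0)
    (summable_int_mul_neg_one_zpow_mul_sq hq hq0).hasSum) (fun x ↦ ?_) ?_
  · rw [doubleTerm_eq hq0]
    simp only [shear, Equiv.coe_fn_mk]
    push_cast
    ring
  · ring

/-- Completing the square: 3j^2 + (6k-1)j = 3(j+k)^2 - (j+k) - 3k^2 + k. -/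
lemma tsum_doubleTerm_three_mul {q : ℂ} (hq : ‖q‖ < 1) (hq0 : q ≠ 0) (k : ℤ) :
    ∑' j, doubleTerm q (3 * k) j = 3 * k * q ^ (3 * tri k + k) * eulerProd (q ^ 2) := by
  refine HasSum.tsum_eq (hasSum_congr (((Equiv.addRight k).hasSum_iff.mpr
    (hasSum_pentagonal_sq hq hq0)).mul_left (3 * k * q ^ (3 * tri k + k))) (fun j ↦ ?_) rfl)
  simp only [doubleTerm, Function.comp_apply, Equiv.coe_addRight]
  have h1 : (-1 : ℂ) ^ (3 * k) * (-1) ^ j = (-1) ^ (j + k) := by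
    rw [← zpow_add₀ (by simp)]
    exact neg_one_zpow_eq_of_even_sub ⟨k, by ring⟩
  have h2 : q ^ tri (3 * k) * q ^ (3 * j ^ 2 + (2 * (3 * k) - 1) * j) =
      q ^ (3 * tri k + k) * q ^ (3 * (j + k) ^ 2 - (j + k)) := by
    rw [← zpow_add₀ hq0, ← zpow_add₀ hq0]
    congr 1
    have t1 := two_mul_tri k
    have t2 := two_mul_tri (3 * k)
    linarith
  rw [← h1]
  push_cast
  linear_combination (3 * k * (-1) ^ (3 * k) * (-1) ^ j : ℂ) * h2

lemma tsum_doubleTerm_three_mul_add_one {q : ℂ} (hq : ‖q‖ < 1) (hq0 : q ≠ 0) (k : ℤ) :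
    ∑' j, doubleTerm q (3 * k + 1) j =
      -(3 * k + 1) * q ^ (3 * tri k + 2 * k) * eulerProd (q ^ 2) := by
  refine HasSum.tsum_eq (hasSum_congr ((((Equiv.addRight k).trans (Equiv.neg ℤ)).hasSum_iff.mpr
    (hasSum_pentagonal_sq hq hq0)).mul_left (-(3 * k + 1) * q ^ (3 * tri k + 2 * k)))
    (fun j ↦ ?_) rfl)
  simp only [doubleTerm, Function.comp_apply, Equiv.trans_apply, Equiv.neg_apply,
    Equiv.coe_addRight]
  have h1 : (-1 : ℂ) ^ (3 * k + 1) * (-1) ^ j = -(-1) ^ (-(j + k)) := by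
    rw [← zpow_add₀ (by simp)]
    exact neg_one_zpow_eq_neg_of_odd_sub ⟨2 * k + j, by ring⟩
  have h2 : q ^ tri (3 * k + 1) * q ^ (3 * j ^ 2 + (2 * (3 * k + 1) - 1) * j) =
      q ^ (3 * tri k + 2 * k) * q ^ (3 * (-(j + k)) ^ 2 - -(j + k)) := by
    rw [← zpow_add₀ hq0, ← zpow_add₀ hq0]
    congr 1
    have t1 := two_mul_tri k
    have t2 := two_mul_tri (3 * k + 1)
    linarith
  push_cast
  linear_combination ((3 * k + 1) * (-1) ^ (3 * k + 1) * (-1) ^ j : ℂ) * h2 +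
    ((3 * k + 1) * q ^ (3 * tri k + 2 * k) * q ^ (3 * (-(j + k)) ^ 2 - -(j + k)) : ℂ) * h1

lemma tsum_doubleTerm_three_mul_add_two (q : ℂ) (k : ℤ) :
    ∑' j, doubleTerm q (3 * k + 2) j = 0 := by
  -- The reflection j ↦ -2k-1-j preserves the exponent and changes the parity of j, so the sum
  -- equals its negative.
  have h := (Equiv.subLeft (-2 * k - 1)).tsum_eq (doubleTerm q (3 * k + 2))
  have h' (j : ℤ) : doubleTerm q (3 * k + 2) (Equiv.subLeft (-2 * k - 1) j) =
      -doubleTerm q (3 * k + 2) j := by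
    simp only [doubleTerm, Equiv.subLeft_apply]
    have h1 : (-1 : ℂ) ^ (-2 * k - 1 - j) = -(-1) ^ j :=
      neg_one_zpow_eq_neg_of_odd_sub ⟨-k - 1 - j, by ring⟩
    rw [h1, show 3 * (-2 * k - 1 - j) ^ 2 + (2 * (3 * k + 2) - 1) * (-2 * k - 1 - j) =
      3 * j ^ 2 + (2 * (3 * k + 2) - 1) * j by ring]
    ring
  simp only [h', tsum_neg] at h
  linear_combination (-1 / 2 : ℂ) * h

/-- The derivative at `1` of the quintuple product identity. -/
theorem hasSum_six_mul_add_one {q : ℂ} (hq : ‖q‖ < 1) (hq0 : q ≠ 0) :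
    HasSum (fun k : ℤ ↦ (6 * k + 1) * q ^ (3 * tri k + 2 * k))
      (eulerProd q ^ 5 / eulerProd (q ^ 2) ^ 2) := by
  have hP := eulerProd_ne_zero (norm_pow_lt_one hq 1)
  set W : ℤ → ℂ := fun n ↦ ∑' j, doubleTerm q n j with hW
  have hD := hasSum_doubleTerm hq hq0
  have hsum : HasSum W (-eulerProd q ^ 5 / eulerProd (q ^ 2)) :=
    hD.prod_fiberwise fun n ↦ (hD.summable.prod_factor n).hasSum
  have h3 : HasSum (fun k : ℤ ↦ ∑ r : Fin 3, W (3 * k + r))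
      (-eulerProd q ^ 5 / eulerProd (q ^ 2)) := by
    refine ((Int.divModEquiv 3).symm.hasSum_iff.mpr hsum).prod_fiberwise fun k ↦ ?_
    refine hasSum_congr (hasSum_fintype _) (fun r ↦ ?_) rfl
    simp [Int.divModEquiv]
    ring_nf
  have i0 : Summable fun k : ℤ ↦ W (3 * k) :=
    hsum.summable.comp_injective (i := fun k : ℤ ↦ 3 * k) fun a b h ↦ by simpa using h
  have i1 : Summable fun k : ℤ ↦ W (3 * k + 1) :=
    hsum.summable.comp_injective (i := fun k : ℤ ↦ 3 * k + 1) fun a b h ↦ by simpa using h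
  have h4 : ∑' k : ℤ, W (3 * k) + ∑' k : ℤ, W (3 * k + 1) =
      -eulerProd q ^ 5 / eulerProd (q ^ 2) := by
    refine (i0.hasSum.add i1.hasSum).unique (hasSum_congr h3 (fun k ↦ ?_) rfl)
    simp [Fin.sum_univ_three, hW, tsum_doubleTerm_three_mul_add_two]
  -- Replacing k by -k in the class n = 3k aligns its exponents with those of n = 3k+1; the weights
  -- then add to -(6k+1).
  have h5 := (((Equiv.neg ℤ).hasSum_iff.mpr i0.hasSum).add i1.hasSum).mul_left
    (-(eulerProd (q ^ 2))⁻¹)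
  rw [h4] at h5
  refine hasSum_congr h5 (fun k ↦ ?_) (by field_simp)
  simp only [Function.comp_apply, Equiv.neg_apply, hW, tsum_doubleTerm_three_mul hq hq0,
    tsum_doubleTerm_three_mul_add_one hq hq0]
  have : 3 * tri (-k) + -k = 3 * tri k + 2 * k := by
    have t1 := two_mul_tri k
    have t2 := two_mul_tri (-k)
    linarith
  rw [this]
  push_cast
  field_simp
  ring

/-! ### Eta functions and the odd integers prime to 3 -/

lemma norm_exp_two_pi_I_mul_lt_one (τ : ℍ) : ‖Complex.exp (2 * Real.pi * Complex.I * τ)‖ < 1 :=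
  UpperHalfPlane.norm_exp_two_pi_I_lt_one τ

lemma eta_eq_exp_mul_eulerProd (z : ℂ) :
    ModularForm.eta z = Complex.exp (2 * Real.pi * Complex.I * z / 24) *
      eulerProd (Complex.exp (2 * Real.pi * Complex.I * z)) := by
  simp only [ModularForm.eta, ModularForm.eta_q_eq_pow, eulerProd]
  simp [Function.Periodic.qParam]

lemma eta_pow_five_div_eta_two_mul_sq (τ : ℍ) :
    ModularForm.eta (τ : ℂ) ^ 5 / ModularForm.eta (2 * (τ : ℂ)) ^ 2 =
      Complex.exp (2 * Real.pi * Complex.I * τ / 24) *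
        (eulerProd (Complex.exp (2 * Real.pi * Complex.I * τ)) ^ 5 /
          eulerProd (Complex.exp (2 * Real.pi * Complex.I * τ) ^ 2) ^ 2) := by
  have e1 : Complex.exp (2 * Real.pi * Complex.I * (2 * τ)) =
      Complex.exp (2 * Real.pi * Complex.I * τ) ^ 2 := by
    rw [← Complex.exp_nat_mul]; congr 1; push_cast; ring
  have e2 : Complex.exp (2 * Real.pi * Complex.I * (2 * τ) / 24) =
      Complex.exp (2 * Real.pi * Complex.I * τ / 24) ^ 2 := by
    rw [← Complex.exp_nat_mul]; congr 1; push_cast; ring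
  rw [eta_eq_exp_mul_eulerProd, eta_eq_exp_mul_eulerProd, e1, e2]
  have h1 := Complex.exp_ne_zero (2 * Real.pi * Complex.I * τ / 24)
  have h2 := eulerProd_ne_zero (norm_pow_lt_one (norm_exp_two_pi_I_mul_lt_one τ) 1)
  field_simp

/-- The map `k ↦ |6k + 1|` from the integers to the odd natural numbers. -/
def oddOfInt (k : ℤ) : {n : ℕ // Odd n} := ⟨(6 * k + 1).natAbs, by grind⟩

lemma oddOfInt_injective : Function.Injective oddOfInt := by
  intro a b h
  have : (6 * a + 1).natAbs = (6 * b + 1).natAbs := congrArg Subtype.val h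
  omega

lemma three_dvd_of_notMem_range_oddOfInt {n : {n : ℕ // Odd n}} (h : n ∉ Set.range oddOfInt) :
    3 ∣ (n : ℕ) := by
  obtain ⟨n, hn⟩ := n
  obtain ⟨m, rfl⟩ := hn
  by_contra h3
  simp only at h3
  -- If m ≡ 1 mod 3 then 3 divides 2m+1. Otherwise 2m+1 is 6a+1 or 6a+5 = |6(-a-1)+1| with a = m/3.
  rcases (by omega : m % 3 = 0 ∨ m % 3 = 2) with hm | hm
  · exact h ⟨(m / 3 : ℕ), Subtype.ext (by simp only [oddOfInt]; omega)⟩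
  · exact h ⟨-((m / 3 : ℕ) : ℤ) - 1, Subtype.ext (by simp only [oddOfInt]; omega)⟩

lemma oddOfInt_mul_legendreSym (k : ℤ) :
    ((oddOfInt k : ℕ) : ℤ) * legendreSym 3 ((oddOfInt k : ℕ) : ℤ) = 6 * k + 1 := by
  simp only [oddOfInt]
  rcases le_or_gt 0 (6 * k + 1) with h | h
  · rw [Int.natAbs_of_nonneg h, legendreSym.mod]
    rw [show (6 * k + 1) % ((3 : ℕ) : ℤ) = 1 by omega, legendreSym.at_one, mul_one]
  · rw [Int.ofNat_natAbs_of_nonpos h.le, legendreSym.mod]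
    rw [show -(6 * k + 1) % ((3 : ℕ) : ℤ) = 2 by omega, show legendreSym 3 2 = -1 by decide]
    ring

end EtaQuotient

open EtaQuotient in
theorem mainTheorem7 (τ : ℍ) :
    HasSum
      (fun n : {n : ℕ // Odd n} =>
        ((n : ℕ) : ℂ) * (legendreSym 3 ((n : ℕ) : ℤ) : ℂ) *
          Complex.exp (2 * (Real.pi : ℂ) * Complex.I * ((n : ℕ) : ℂ) ^ 2 * (τ : ℂ) / 24))
      (ModularForm.eta (τ : ℂ) ^ 5 / ModularForm.eta (2 * (τ : ℂ)) ^ 2) := by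
  rw [← oddOfInt_injective.hasSum_iff]
  · refine hasSum_congr ((hasSum_six_mul_add_one (norm_exp_two_pi_I_mul_lt_one τ)
      (Complex.exp_ne_zero _)).mul_left (Complex.exp (2 * Real.pi * Complex.I * τ / 24)))
      (fun k ↦ ?_) (eta_pow_five_div_eta_two_mul_sq τ)
    have h1 : ((oddOfInt k : ℕ) : ℂ) * (legendreSym 3 ((oddOfInt k : ℕ) : ℤ) : ℂ) = 6 * k + 1 := by
      exact_mod_cast congrArg (Int.cast : ℤ → ℂ) (oddOfInt_mul_legendreSym k)
    have h2 : ((oddOfInt k : ℕ) : ℂ) ^ 2 = (6 * k + 1) ^ 2 := by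
      have : ((oddOfInt k : ℕ) : ℤ) ^ 2 = (6 * k + 1) ^ 2 := Int.natAbs_sq _
      exact_mod_cast congrArg (Int.cast : ℤ → ℂ) this
    have h3 : (2 * tri k : ℂ) = k * (k - 1) := by exact_mod_cast two_mul_tri k
    simp only [Function.comp_apply]
    rw [h1, h2, mul_left_comm, ← Complex.exp_int_mul, ← Complex.exp_add]
    congr 2
    push_cast
    -- This is 24(3 tri k + 2k) + 1 = (6k+1)^2.
    linear_combination (-(2 * Real.pi * Complex.I * τ) * 3 / 2) * h3
  · intro n hn
    have : legendreSym 3 ((n : ℕ) : ℤ) = 0 := by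
      rw [legendreSym.eq_zero_iff]
      have := three_dvd_of_notMem_range_oddOfInt hn
      exact_mod_cast (ZMod.natCast_eq_zero_iff _ 3).mpr this
    simp [this]
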